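/- Let $1\le M\le K$ be integers and let $\mathbb F_q$ be a finite field. In single-server private information retrieval with private coded side information (PIR-PCSI), a server stores $K$ messages $W_1,\dots,W_K\in\mathbb F_q^L$, $L\ge 1$. Let $\theta$ be uniform on $[K]=\{1,\dots,K\}$, $\mathcal S$ uniform on the $M$-element subsets of $[K]$, $\Lambda=(\lambda_1,\dots,\lambda_M)$ uniform on $(\mathbb F_q\setminus\{0\})^M$, and $W_{[K]}=(W_1,\dots,W_K)$ uniform on $(\mathbb F_q^L)^K$, all independent. The user knows $\theta$, $\mathcal S=\{i_1<\dots<i_M\}$, $\Lambda$ and $Y=\lambda_1W_{i_1}+\dots+\lambda_MW_{i_M}$. A scheme consists of a discrete random query $Q$ with $I(W_{[K]};Q,\theta,\mathcal S,\Lambda)=0$ and an answer $\Delta$, a string of symbols of $\mathbb F_q$ whose possible values for each given query form a prefix-free code, with $H(\Delta\mid Q,W_{[K]})=0$, such that $$I(\theta,\mathcal S;Q,W_{[K]})=0\quad\text{(privacy)},\qquad H(W_\theta\mid \Delta,Q,Y,\mathcal S,\Lambda,\theta)=0\quad\text{(correctness)}.$$ Its rate is $L/D$, where $D$ is the expected length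 of $\Delta$. The capacity $C_{\mathrm{PCSI}}(q)$ is the supremum of the rates of all schemes over $\mathbb F_q$, over all $L\ge1$, and the supremum capacity is $C^{\sup}_{\mathrm{PCSI}}=\sup_q C_{\mathrm{PCSI}}(q)$, over all finite fields. **Theorem.** For all integers $1\le M\le K$ (with $1/0=\infty$ in the degenerate case $K=M=1$), $$C^{\sup}_{\mathrm{PCSI}}=\max\left(\frac1{K-1},\frac1{K-M+1}\right)=\begin{cases}\dfrac1{K-1},& M=1,\\[2mm]\dfrac1{K-M+1},&2\le M\le K.\end{cases}$$ -/

import Mathlib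

open scoped ENNReal

noncomputable section

namespace PCSI

/-! ### Information measures of discrete random variables

A discrete probability space is a type `Ω` with a `P : PMF Ω`; a random variable is any function
on `Ω`, and its law is `P.map X`. Logarithms are natural; the base is immaterial, as the problem
only asks whether such a quantity vanishes. -/

/-- The product of two discrete laws. -/
def prodLaw {α β : Type} (p : PMF α) (q : PMF β) : PMF (α × β) :=
  p.bind fun a => q.map (Prod.mk a)

/-- Mutual information `I(X; Y)`: the Kullback-Leibler divergence of the joint law from the
product of the marginal laws. -/
def mutualInfo {Ω α β : Type} (P : PMF Ω) (X : Ω → α) (Y : Ω → β) : ℝ≥0∞ :=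
  letI : MeasurableSpace (α × β) := ⊤
  InformationTheory.klDiv (P.map fun ω => (X ω, Y ω)).toMeasure
    (prodLaw (P.map X) (P.map Y)).toMeasure

/-- Conditional entropy `H(X | Y) = ∑ p(x, y) log (p(y) / p(x, y))`. As `p(x, y) ≤ p(y)`, all
terms are nonnegative, so the sum is meaningful in `[0, ∞]`. -/
def condEntropy {Ω α β : Type} (P : PMF Ω) (X : Ω → α) (Y : Ω → β) : ℝ≥0∞ :=
  ∑' z : α × β, ENNReal.ofReal
    ((P.map (fun ω => (X ω, Y ω)) z).toReal *
      Real.log ((P.map Y z.2).toReal / (P.map (fun ω => (X ω, Y ω)) z).toReal))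

/-- `X` is uniformly distributed over the finite type `α`. -/
def IsUniform {Ω α : Type} (P : PMF Ω) (X : Ω → α) : Prop :=
  ∀ a, P.map X a = (Nat.card α : ℝ≥0∞)⁻¹

/-! ### The retrieval problem -/

/-- Possible supports of the side information: the subsets of `[K]` of cardinality `M`. -/
abbrev Support (K M : ℕ) : Type := {S : Finset (Fin K) // S.card = M}

/-- Coefficient vectors: `M` nonzero elements of `F`. -/
abbrev Coeffs (F : Type) [Field F] (M : ℕ) : Type := Fin M → Fˣ

/-- `K` messages of `L` symbols each. -/
abbrev Messages (F : Type) (K L : ℕ) : Type := Fin K → Fin L → F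

/-- The coded side information `Y^{[S, Λ]} = λ₁ W_{S(1)} + ⋯ + λ_M W_{S(M)}`, where `S(m)` is the
`m`-th element of `S` in ascending order. -/
def sideInfo {F : Type} [Field F] {K M L : ℕ} (S : Support K M) (Λ : Coeffs F M)
    (W : Messages F K L) : Fin L → F :=
  ∑ m : Fin M, (Λ m : F) • W (S.1.orderEmbOfFin S.2 m)

/-- A (correct and private) PIR-PCSI scheme with `K` messages in `F ^ L` and side information of
support size `M`. The answer is a string of symbols of `F`. -/
structure Scheme (F : Type) [Field F] (K M L : ℕ) where
  /-- sample space -/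
  Ω : Type
  /-- probability law -/
  P : PMF Ω
  /-- index of the desired message -/
  θ : Ω → Fin K
  /-- support of the side information -/
  S : Ω → Support K M
  /-- coefficients of the side information -/
  Λ : Ω → Coeffs F M
  /-- messages -/
  W : Ω → Messages F K L
  /-- alphabet of the query -/
  Query : Type
  /-- query -/
  Q : Ω → Query
  /-- answer -/
  Δ : Ω → List F
  /-- `θ`, `S`, `Λ`, `W` are independent, each of them uniform over all its possible values. -/
  uniform : IsUniform P fun ω => (θ ω, S ω, Λ ω, W ω)
  /-- The query (jointly with `θ, S, Λ`) is independent of the messages. -/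
  query_indep : mutualInfo P W (fun ω => (Q ω, θ ω, S ω, Λ ω)) = 0
  /-- `(θ, S)` is private. -/
  privacy : mutualInfo P (fun ω => (θ ω, S ω)) (fun ω => (Q ω, W ω)) = 0
  /-- The answer is a function of the query and the messages. -/
  answer_determined : condEntropy P Δ (fun ω => (Q ω, W ω)) = 0
  /-- The possible answers to a given query form a prefix code: where the download ends is
  visible from the downloaded symbols themselves (and from the query), so that its length carries
  no uncharged information. -/
  answer_prefix : ∀ ω ∈ P.support, ∀ ω' ∈ P.support, Q ω = Q ω' → Δ ω <+: Δ ω' → Δ ω = Δ ω'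
  /-- The desired message can be decoded. -/
  correctness : condEntropy P (fun ω => W ω (θ ω))
    (fun ω => (Δ ω, Q ω, sideInfo (S ω) (Λ ω) (W ω), S ω, Λ ω, θ ω)) = 0

/-- The average download `D`, in symbols of `F`. -/
def Scheme.download {F : Type} [Field F] {K M L : ℕ} (s : Scheme F K M L) : ℝ≥0∞ :=
  ∑' ω, s.P ω * ((s.Δ ω).length : ℝ≥0∞)

/-- The rate `R = L / D`. For `L ≥ 1` it is `∞` if nothing is downloaded. -/
def Scheme.rate {F : Type} [Field F] {K M L : ℕ} (s : Scheme F K M L) : ℝ≥0∞ :=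
  (L : ℝ≥0∞) / s.download

/-- The capacity over the field `F`: the supremum of the achievable rates over all message
sizes `L ≥ 1`. -/
def capacity (F : Type) [Field F] (K M : ℕ) : ℝ≥0∞ :=
  ⨆ (L : ℕ) (_ : 1 ≤ L) (s : Scheme F K M L), s.rate

/-- The supremum capacity: the supremum of the capacity over all finite fields. -/
def supCapacity (K M : ℕ) : ℝ≥0∞ :=
  ⨆ (F : Type) (_ : Field F) (_ : Finite F), capacity F K M

end PCSI

end

/-! Converse: fix a query in the support. Privacy makes it compatible with every pair `(θ, S)` for
some `Λ`, and independence of the messages makes it compatible with every message tuple. So one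
answer map must serve all demands. For `M ≥ 2`, let the demand lie in `S`: the answer and `Y` reveal
that message, and `M - 2` further messages of `S` turn `Y` into the last one. All of `S` is then
known, and with it every side information on `S`, so every message is decodable. A fibre of the
answer map thus holds at most `q ^ ((M - 1) * L)` tuples; for `M = 1` a single message plays this
role (`exists_injOn_fibre`). Kraft's inequality turns the fibre bound into expected length at least
`(K - max (M - 1) 1) * L` (`Scheme.le_download`).

Achievability: for `M = 1`, download the `K - 1` differences with one message. In general, download
`∑ i, s i * x i ^ j * W i` for `j ≤ K - M`. The user picks `s` so that one combination of these
agrees with `Y` up to a nonzero multiple of the desired message (`eq_of_sum_pow_eq`). As `Λ` and the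
private scalars are uniform, `s` is uniform given `(θ, S)` and the messages, hence private. -/

noncomputable section

namespace PCSI

/-! ### Vanishing information measures and uniform laws -/

section Information

variable {Ω α β γ δ : Type}

lemma prodLaw_apply (p : PMF α) (q : PMF β) (a : α) (b : β) :
    prodLaw p q (a, b) = p a * q b := by
  classical
  unfold prodLaw
  rw [PMF.bind_apply, tsum_eq_single a]
  · rw [PMF.map_apply, tsum_eq_single b] <;> simp +contextual [eq_comm]
  · intro a' ha'
    rw [PMF.map_apply]
    simp [ha'.symm]

lemma map_prodLaw (p : PMF α) (q : PMF β) (f : α → γ) (g : β → δ) :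
    (prodLaw p q).map (Prod.map f g) = prodLaw (p.map f) (q.map g) := by
  simp only [prodLaw, PMF.map_bind, PMF.bind_map, PMF.map_comp]
  rfl

lemma map_fst_prodLaw (p : PMF α) (q : PMF β) : (prodLaw p q).map Prod.fst = p := by
  simp only [prodLaw, PMF.map_bind, PMF.map_comp]
  have : ∀ a : α, (q.map (Prod.fst ∘ Prod.mk a)) = PMF.pure a := fun a => PMF.map_const q a
  rw [funext this, PMF.bind_pure]

lemma map_snd_prodLaw (p : PMF α) (q : PMF β) : (prodLaw p q).map Prod.snd = q := by
  simp only [prodLaw, PMF.map_bind, PMF.map_comp]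
  have : ∀ a : α, (q.map (Prod.snd ∘ Prod.mk a)) = q := fun a => PMF.map_id q
  rw [funext this, PMF.bind_const]

lemma mutualInfo_eq_zero_iff (P : PMF Ω) (X : Ω → α) (Y : Ω → β) :
    mutualInfo P X Y = 0 ↔ (P.map fun ω => (X ω, Y ω)) = prodLaw (P.map X) (P.map Y) := by
  let _ : MeasurableSpace (α × β) := ⊤
  unfold mutualInfo
  rw [InformationTheory.klDiv_eq_zero_iff]
  exact PMF.toMeasure_inj

lemma mutualInfo_comp_eq_zero {P : PMF Ω} {X : Ω → α} {Y : Ω → β} (h : mutualInfo P X Y = 0)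
    (f : α → γ) (g : β → δ) :
    mutualInfo P (fun ω => f (X ω)) (fun ω => g (Y ω)) = 0 := by
  rw [mutualInfo_eq_zero_iff] at h ⊢
  have := congrArg (PMF.map (Prod.map f g)) h
  rw [map_prodLaw, PMF.map_comp, PMF.map_comp, PMF.map_comp] at this
  exact this

lemma map_pair_apply_of_mutualInfo_eq_zero {P : PMF Ω} {X : Ω → α} {Y : Ω → β}
    (h : mutualInfo P X Y = 0) (a : α) (b : β) :
    P.map (fun ω => (X ω, Y ω)) (a, b) = P.map X a * P.map Y b := by
  rw [(mutualInfo_eq_zero_iff P X Y).1 h, prodLaw_apply]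

/-- Independent variables take any two of their possible values simultaneously. -/
lemma exists_mem_support_of_mutualInfo_eq_zero {P : PMF Ω} {X : Ω → α} {Y : Ω → β}
    (h : mutualInfo P X Y = 0) {ω₁ ω₂ : Ω} (h₁ : ω₁ ∈ P.support) (h₂ : ω₂ ∈ P.support) :
    ∃ ω ∈ P.support, X ω = X ω₁ ∧ Y ω = Y ω₂ := by
  have hX : P.map X (X ω₁) ≠ 0 :=
    (PMF.mem_support_iff _ _).1 ((PMF.mem_support_map_iff ..).2 ⟨ω₁, h₁, rfl⟩)
  have hY : P.map Y (Y ω₂) ≠ 0 :=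
    (PMF.mem_support_iff _ _).1 ((PMF.mem_support_map_iff ..).2 ⟨ω₂, h₂, rfl⟩)
  have hXY := mul_ne_zero hX hY
  rw [← map_pair_apply_of_mutualInfo_eq_zero h] at hXY
  obtain ⟨ω, hω, e⟩ := (PMF.mem_support_map_iff ..).1 ((PMF.mem_support_iff _ _).2 hXY)
  exact ⟨ω, hω, congrArg Prod.fst e, congrArg Prod.snd e⟩

/-- A term of the entropy sum vanishes exactly when the joint mass is zero or equals the marginal
mass of `Y`. This turns correctness and determinacy of the answer into statements about the support.
-/
lemma condEntropy_eq_zero_iff (P : PMF Ω) (X : Ω → α) (Y : Ω → β) :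
    condEntropy P X Y = 0 ↔
      ∀ ω ∈ P.support, ∀ ω' ∈ P.support, Y ω = Y ω' → X ω = X ω' := by
  classical
  unfold condEntropy
  rw [ENNReal.tsum_eq_zero]
  constructor
  · intro h ω hω ω' hω' hY
    by_contra hX
    generalize hp : P.map (fun ω => (X ω, Y ω)) = p at h
    have h1 : p (X ω, Y ω) ≠ 0 :=
      hp ▸ (PMF.mem_support_iff _ _).1 ((PMF.mem_support_map_iff ..).2 ⟨ω, hω, rfl⟩)
    have h2 : p (X ω', Y ω) ≠ 0 :=
      hp ▸ (PMF.mem_support_iff _ _).1 ((PMF.mem_support_map_iff ..).2 ⟨ω', hω', by simp [hY]⟩)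
    have hle : p (X ω, Y ω) + p (X ω', Y ω) ≤ P.map Y (Y ω) := by
      have hmap : P.map Y = p.map Prod.snd := by rw [← hp, PMF.map_comp]; rfl
      rw [hmap, PMF.map_apply]
      refine le_trans (le_of_eq ?_)
        (ENNReal.sum_le_tsum ({(X ω, Y ω), (X ω', Y ω)} : Finset (α × β)))
      rw [Finset.sum_pair (by simp [hX])]
      simp
    have hlt : p (X ω, Y ω) < P.map Y (Y ω) :=
      lt_of_lt_of_le (ENNReal.lt_add_right (PMF.apply_ne_top _ _) h2) hle
    have hpos : 0 < (p (X ω, Y ω)).toReal := ENNReal.toReal_pos h1 (PMF.apply_ne_top _ _)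
    have hlt' := (ENNReal.toReal_lt_toReal (PMF.apply_ne_top _ _) (PMF.apply_ne_top _ _)).2 hlt
    have := h (X ω, Y ω)
    rw [ENNReal.ofReal_eq_zero] at this
    exact absurd this (not_le.2 (mul_pos hpos (Real.log_pos ((one_lt_div hpos).2 hlt'))))
  · rintro h ⟨x, y⟩
    by_cases h0 : P.map (fun ω => (X ω, Y ω)) (x, y) = 0
    · simp [h0]
    obtain ⟨ω, hω, e⟩ := (PMF.mem_support_map_iff ..).1 ((PMF.mem_support_iff _ _).2 h0)
    obtain ⟨rfl, rfl⟩ := Prod.mk.inj e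
    have heq : P.map Y (Y ω) = P.map (fun ω => (X ω, Y ω)) (X ω, Y ω) := by
      rw [PMF.map_apply, PMF.map_apply]
      refine tsum_congr fun ω' => ?_
      by_cases hω' : P ω' = 0
      · simp [hω']
      by_cases hY : Y ω = Y ω'
      · simp [hY, h ω hω ω' hω' hY]
      · simp [hY]
    simp only [heq]
    rw [div_self (ENNReal.toReal_pos h0 (PMF.apply_ne_top _ _)).ne']
    simp

lemma tsum_map_mul (P : PMF Ω) (X : Ω → α) (g : α → ℝ≥0∞) :
    ∑' a, P.map X a * g a = ∑' ω, P ω * g (X ω) := by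
  classical
  simp_rw [PMF.map_apply, ← ENNReal.tsum_mul_right]
  rw [ENNReal.tsum_comm]
  refine tsum_congr fun ω => ?_
  rw [tsum_eq_single (X ω)] <;> simp +contextual

lemma IsUniform.map_equiv {P : PMF Ω} {X : Ω → α} (h : IsUniform P X) (e : α ≃ β) :
    IsUniform P fun ω => e (X ω) := by
  classical
  intro b
  have := h (e.symm b)
  rw [Nat.card_congr e] at this
  rw [← this, PMF.map_apply, PMF.map_apply]
  simp only [Equiv.symm_apply_eq]

lemma IsUniform.snd [Finite α] [Nonempty α] [Finite β] {P : PMF Ω} {X : Ω → α} {Y : Ω → β}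
    (h : IsUniform P fun ω => (X ω, Y ω)) : IsUniform P Y := by
  classical
  have := Fintype.ofFinite α
  have := Fintype.ofFinite β
  intro b
  have hmap : P.map Y = (P.map fun ω => (X ω, Y ω)).map Prod.snd := by rw [PMF.map_comp]; rfl
  rw [hmap, PMF.map_apply]
  refine (ENNReal.tsum_prod (f := fun a b' =>
    if b = b' then (P.map fun ω => (X ω, Y ω)) (a, b') else 0)).trans ?_
  have h0 : (Nat.card α : ℝ≥0∞) ≠ 0 := by simp
  have hb : (Nat.card β : ℝ≥0∞) ≠ 0 := by
    have : Nonempty β := ⟨b⟩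
    simp
  have (a : α) : ∑' b', (if b = b' then (P.map fun ω => (X ω, Y ω)) (a, b') else 0)
      = ((Nat.card α : ℝ≥0∞) * Nat.card β)⁻¹ := by
    rw [tsum_eq_single b]
    · simp [h (a, b)]
    · simp +contextual [eq_comm]
  rw [tsum_congr this, tsum_fintype, Finset.sum_const, Finset.card_univ, nsmul_eq_mul,
    ← Nat.card_eq_fintype_card, ENNReal.mul_inv (by simp) (by simp), ← mul_assoc,
    ENNReal.mul_inv_cancel h0 (by simp), one_mul]

lemma IsUniform.exists_mem_support [Finite α] {P : PMF Ω} {X : Ω → α} (h : IsUniform P X)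
    (a : α) : ∃ ω ∈ P.support, X ω = a := by
  have : P.map X a ≠ 0 := by rw [h a]; simp
  exact (PMF.mem_support_map_iff ..).1 ((PMF.mem_support_iff _ _).2 this)

lemma uniformOfFintype_prod [Fintype α] [Nonempty α] [Fintype β] [Nonempty β] :
    PMF.uniformOfFintype (α × β) =
      prodLaw (PMF.uniformOfFintype α) (PMF.uniformOfFintype β) := by
  ext ⟨a, b⟩
  rw [prodLaw_apply]
  simp [ENNReal.mul_inv]

lemma map_equiv_uniformOfFintype [Fintype α] [Nonempty α] [Fintype β] [Nonempty β]
    (e : α ≃ β) : (PMF.uniformOfFintype α).map e = PMF.uniformOfFintype β := by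
  classical
  ext b
  rw [PMF.map_apply, tsum_eq_single (e.symm b)]
  · simp [Fintype.card_congr e]
  · intro a ha
    rw [if_neg]
    rintro rfl
    simp at ha

lemma isUniform_fst [Fintype α] [Nonempty α] [Fintype β] [Nonempty β] :
    IsUniform (PMF.uniformOfFintype (α × β)) Prod.fst := by
  intro a
  rw [uniformOfFintype_prod, map_fst_prodLaw]
  simp

/-- The two components of a uniform pair are independent. -/
lemma mutualInfo_uniformOfFintype_eq_zero [Fintype Ω] [Nonempty Ω] [Fintype α] [Nonempty α]
    [Fintype β] [Nonempty β] (e : Ω ≃ α × β) :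
    mutualInfo (PMF.uniformOfFintype Ω) (fun ω => (e ω).1) (fun ω => (e ω).2) = 0 := by
  rw [mutualInfo_eq_zero_iff]
  have h1 : (PMF.uniformOfFintype Ω).map (fun ω => (e ω).1) =
      ((PMF.uniformOfFintype Ω).map e).map Prod.fst := by rw [PMF.map_comp]; rfl
  have h2 : (PMF.uniformOfFintype Ω).map (fun ω => (e ω).2) =
      ((PMF.uniformOfFintype Ω).map e).map Prod.snd := by rw [PMF.map_comp]; rfl
  rw [h1, h2, map_equiv_uniformOfFintype, uniformOfFintype_prod, map_fst_prodLaw,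
    map_snd_prodLaw, ← uniformOfFintype_prod, ← map_equiv_uniformOfFintype e]

end Information


/-! ### Prefix-free codes and expected length -/

section Codes

variable {α ι : Type}

lemma uniquelyDecodable_of_prefixFree {S : Set (List α)}
    (hS : ∀ v ∈ S, ∀ w ∈ S, v <+: w → v = w) (hnil : [] ∉ S) :
    InformationTheory.UniquelyDecodable S := by
  intro L₁
  induction L₁ with
  | nil =>
    intro L₂ _ h₂ h
    cases L₂ with
    | nil => rfl
    | cons v L₂ =>
      simp only [List.flatten_nil, List.flatten_cons] at h
      have hv : v = [] := (List.append_eq_nil_iff.1 h.symm).1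
      exact absurd (h₂ v (by simp)) (hv ▸ hnil)
  | cons w L₁ ih =>
    intro L₂ h₁ h₂ h
    cases L₂ with
    | nil =>
      simp only [List.flatten_nil, List.flatten_cons] at h
      have hw : w = [] := (List.append_eq_nil_iff.1 h).1
      exact absurd (h₁ w (by simp)) (hw ▸ hnil)
    | cons v L₂ =>
      simp only [List.flatten_cons] at h
      have hw : w ∈ S := h₁ w (by simp)
      have hv : v ∈ S := h₂ v (by simp)
      have hwv : w = v := by
        rcases List.prefix_or_prefix_of_prefix (List.prefix_append w L₁.flatten)
          (h ▸ List.prefix_append v L₂.flatten) with hp | hp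
        · exact hS w hw v hv hp
        · exact (hS v hv w hw hp).symm
      subst hwv
      rw [ih L₂ (fun x hx => h₁ x (by simp [hx])) (fun x hx => h₂ x (by simp [hx]))
        (List.append_cancel_left h)]

/-- Kraft's inequality for prefix-free codes. -/
lemma kraft_of_prefixFree [Fintype α] [Nonempty α] {S : Finset (List α)}
    (hS : ∀ v ∈ S, ∀ w ∈ S, v <+: w → v = w) :
    ∑ w ∈ S, (1 / Fintype.card α : ℝ) ^ w.length ≤ 1 := by
  by_cases hnil : [] ∈ S
  · have : S = {[]} := by
      ext w
      simp only [Finset.mem_singleton]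
      exact ⟨fun hw => (hS [] hnil w hw List.nil_prefix).symm, fun hw => hw ▸ hnil⟩
    simp [this]
  · exact InformationTheory.kraft_mcmillan_inequality
      (uniquelyDecodable_of_prefixFree (S := (S : Set (List α))) hS hnil)

/-- A prefix-free encoding of a uniform variable none of whose codewords has probability
exceeding `|α| ^ (-d)` has expected length at least `d`. -/
lemma card_mul_le_sum_length [Fintype α] [Nontrivial α] [Fintype ι] [DecidableEq (List α)]
    (f : ι → List α) (hf : ∀ i j, f i <+: f j → f i = f j) (d : ℕ)
    (hd : ∀ i, (Finset.univ.filter fun j => f j = f i).card * Fintype.card α ^ d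
      ≤ Fintype.card ι) :
    Fintype.card ι * d ≤ ∑ i, (f i).length := by
  set q : ℝ := (Fintype.card α : ℝ) with hq
  have hq1 : 1 < q := by rw [hq]; exact_mod_cast Fintype.one_lt_card
  have hq0 : 0 < q := by linarith
  have hlog : 0 < Real.log q := Real.log_pos hq1
  let n : List α → ℝ := fun c => (Finset.univ.filter fun j => f j = c).card
  have hn : ∀ i, 0 < n (f i) := fun i => by
    have : 0 < (Finset.univ.filter fun j => f j = f i).card :=
      Finset.card_pos.2 ⟨i, by simp⟩
    exact Nat.cast_pos.2 this
  -- Gibbs' inequality termwise: `log t ≤ t - 1`, after bounding `q ^ d` by the inverse probability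
  -- of the codeword.
  have hterm : ∀ i, ((d : ℝ) - (f i).length) * Real.log q ≤
      Fintype.card ι * ((1 / q) ^ (f i).length / n (f i)) - 1 := by
    intro i
    have hdi : n (f i) * q ^ d ≤ Fintype.card ι := by
      simp only [n, hq]
      exact_mod_cast hd i
    have h1 : ((d : ℝ) - (f i).length) * Real.log q
        = Real.log (q ^ d * (1 / q) ^ (f i).length) := by
      rw [Real.log_mul (by positivity) (by positivity), Real.log_pow, Real.log_pow]
      simp
      ring
    have h2 : q ^ d ≤ Fintype.card ι / n (f i) := by
      rw [le_div_iff₀ (hn i)]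
      linarith
    rw [h1]
    refine (Real.log_le_sub_one_of_pos (by positivity)).trans ?_
    have : q ^ d * (1 / q) ^ (f i).length ≤
        Fintype.card ι / n (f i) * (1 / q) ^ (f i).length := by gcongr
    have e : (Fintype.card ι : ℝ) / n (f i) * (1 / q) ^ (f i).length
        = Fintype.card ι * ((1 / q) ^ (f i).length / n (f i)) := by ring
    linarith
  have hsum := Finset.sum_le_sum fun i (_ : i ∈ Finset.univ) => hterm i
  have hkraft : ∑ i, (1 / q) ^ (f i).length / n (f i) ≤ 1 := by
    -- Each codeword `c` occurs `n c` times, which cancels the denominator and leaves the Kraft sum.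
    rw [Finset.sum_comp (fun c : List α => (1 / q) ^ c.length / n c) f]
    refine le_trans (le_of_eq ?_) (kraft_of_prefixFree (S := Finset.univ.image f) ?_)
    · refine Finset.sum_congr rfl fun c hc => ?_
      obtain ⟨i, -, rfl⟩ := Finset.mem_image.1 hc
      rw [nsmul_eq_mul]
      exact mul_div_cancel₀ _ (hn i).ne'
    · intro v hv w hw h
      obtain ⟨i, -, rfl⟩ := Finset.mem_image.1 hv
      obtain ⟨j, -, rfl⟩ := Finset.mem_image.1 hw
      exact hf i j h
  rw [← Finset.sum_mul, Finset.sum_sub_distrib, Finset.sum_sub_distrib, ← Finset.mul_sum]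
    at hsum
  simp only [Finset.sum_const, Finset.card_univ, nsmul_eq_mul, mul_one] at hsum
  have hle : ((Fintype.card ι : ℝ) * d - ∑ i, ((f i).length : ℝ)) * Real.log q ≤ 0 := by
    refine hsum.trans ?_
    have : (Fintype.card ι : ℝ) * ∑ i, (1 / q) ^ (f i).length / n (f i) ≤ Fintype.card ι * 1 := by
      gcongr
    linarith
  have := nonpos_of_mul_nonpos_left hle hlog
  have : (Fintype.card ι : ℝ) * d ≤ ∑ i, ((f i).length : ℝ) := by linarith
  exact_mod_cast this

end Codes

/-! ### Size of the fibres of a universal answer map -/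

section Fibres

variable {F : Type} [Field F] {K M L : ℕ}

/-- If an answer `f` allows decoding every message from any support of side information, then
its fibres embed into the space of `max (M - 1) 1` messages. -/
lemma exists_injOn_fibre {C : Type} (hM : 1 ≤ M) (hMK : M ≤ K) (f : Messages F K L → C)
    (hf : ∀ (θ : Fin K) (S : Support K M), ∃ Λ : Coeffs F M, ∀ w w' : Messages F K L,
      f w = f w' → sideInfo S Λ w = sideInfo S Λ w' → w θ = w' θ) :
    ∃ g : Messages F K L → (Fin (max (M - 1) 1) → Fin L → F),
      ∀ w w', f w = f w' → g w = g w' → w = w' := by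
  obtain ⟨S, -, hS⟩ := Finset.exists_subset_card_eq (s := (Finset.univ : Finset (Fin K)))
    (n := M) (by simpa using hMK)
  let S' : Support K M := ⟨S, hS⟩
  let e := S.orderEmbOfFin hS
  have hall : ∀ w w' : Messages F K L, f w = f w' → (∀ m, w (e m) = w' (e m)) → w = w' := by
    intro w w' h he
    funext θ
    obtain ⟨Λ, hΛ⟩ := hf θ S'
    refine hΛ w w' h ?_
    exact Finset.sum_congr rfl fun m _ => congrArg _ (he m)
  rcases M with _ | _ | m
  · omega
  · refine ⟨fun w _ => w (e 0), fun w w' h hg => hall w w' h fun i => ?_⟩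
    obtain rfl : i = 0 := Fin.ext (by omega)
    exact congrFun hg ⟨0, by simp⟩
  -- The demand is taken inside the support. Recording `Y` and the messages at `e 2, e 3, …`
  -- suffices: `Y` yields `e 0`, and then `e 1` because its coefficient is nonzero.
  · obtain ⟨Λ, hΛ⟩ := hf (e 0) S'
    have hmax : max (m + 2 - 1) 1 = m + 1 := by omega
    rw [hmax]
    refine ⟨fun w => Fin.cons (sideInfo S' Λ w) fun j : Fin m => w (e j.succ.succ),
      fun w w' h hg => hall w w' h ?_⟩
    obtain ⟨hY, hr⟩ := Fin.cons_inj.1 hg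
    have h0 : w (e 0) = w' (e 0) := hΛ w w' h hY
    have hr' : ∀ j : Fin m, w (e j.succ.succ) = w' (e j.succ.succ) := fun j => congrFun hr j
    have h1 : w (e 1) = w' (e 1) := by
      have hY' : ∑ i, (Λ i : F) • w (e i) = ∑ i, (Λ i : F) • w' (e i) := hY
      rw [Fin.sum_univ_succ, Fin.sum_univ_succ, Fin.sum_univ_succ (n := m + 1),
        Fin.sum_univ_succ (n := m), h0, Finset.sum_congr rfl fun j _ => by rw [hr' j],
        add_right_inj, add_left_inj] at hY'
      exact smul_right_injective _ (Λ 1).ne_zero hY'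
    intro i
    refine Fin.cases h0 (fun i => Fin.cases h1 hr' i) i

lemma card_fibre_mul_le [Fintype F] [DecidableEq F] (hM : 1 ≤ M) (hMK : M ≤ K)
    (f : Messages F K L → List F)
    (hf : ∀ (θ : Fin K) (S : Support K M), ∃ Λ : Coeffs F M, ∀ w w' : Messages F K L,
      f w = f w' → sideInfo S Λ w = sideInfo S Λ w' → w θ = w' θ) (w : Messages F K L) :
    (Finset.univ.filter fun w' => f w' = f w).card
      * Fintype.card F ^ ((K - max (M - 1) 1) * L) ≤ Fintype.card (Messages F K L) := by
  obtain ⟨g, hg⟩ := exists_injOn_fibre hM hMK f hf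
  have h1 : (Finset.univ.filter fun w' => f w' = f w).card ≤
      Fintype.card F ^ (max (M - 1) 1 * L) := by
    refine (Finset.card_le_card_of_injOn g (t := Finset.univ) (fun _ _ => by simp) ?_).trans
      (le_of_eq ?_)
    · intro a ha b hb hab
      simp only [Finset.coe_filter, Finset.mem_univ, true_and, Set.mem_ofPred_eq] at ha hb
      exact hg a b (ha.trans hb.symm) hab
    · simp [pow_mul']
  refine (Nat.mul_le_mul_right _ h1).trans (le_of_eq ?_)
  rw [← pow_add, ← Nat.add_mul]
  have : max (M - 1) 1 + (K - max (M - 1) 1) = K := by omega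
  rw [this]
  simp [pow_mul']

end Fibres


/-! ### Lower bound on the download -/

section Converse

variable {F : Type} [Field F] {K M L : ℕ}

/-- The answer is a function of query and messages. -/
lemma Scheme.exists_answer (s : Scheme F K M L) :
    ∃ f : s.Query → Messages F K L → List F, ∀ ω ∈ s.P.support, s.Δ ω = f (s.Q ω) (s.W ω) := by
  classical
  refine ⟨fun q w => if h : ∃ ω ∈ s.P.support, (s.Q ω, s.W ω) = (q, w) then s.Δ h.choose else [],
    fun ω hω => ?_⟩
  have h : ∃ ω' ∈ s.P.support, (s.Q ω', s.W ω') = (s.Q ω, s.W ω) := ⟨ω, hω, rfl⟩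
  simp only [dif_pos h]
  exact (condEntropy_eq_zero_iff _ _ _).1 s.answer_determined _ hω _ h.choose_spec.1
    h.choose_spec.2.symm

/-- For each query the expected length of the answer is at least `(K - max (M - 1) 1) * L`. -/
lemma Scheme.card_mul_le_sum_length [Fintype F] (hM : 1 ≤ M) (hMK : M ≤ K) (s : Scheme F K M L)
    {f : s.Query → Messages F K L → List F}
    (hf : ∀ ω ∈ s.P.support, s.Δ ω = f (s.Q ω) (s.W ω)) {ω₀ : s.Ω} (hω₀ : ω₀ ∈ s.P.support) :
    Fintype.card (Messages F K L) * ((K - max (M - 1) 1) * L) ≤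
      ∑ w, (f (s.Q ω₀) w).length := by
  classical
  -- `Λ` is chosen before `w`: privacy supplies a realisation of the query with `(θ, S)`, which
  -- fixes `Λ`, and independence then swaps in any messages.
  have hex : ∀ (θ : Fin K) (S : Support K M), ∃ Λ : Coeffs F M, ∀ w : Messages F K L,
      ∃ ω ∈ s.P.support, s.W ω = w ∧ (s.Q ω, s.θ ω, s.S ω, s.Λ ω) = (s.Q ω₀, θ, S, Λ) := by
    intro θ S
    obtain ⟨ω₁, hω₁, h₁⟩ := s.uniform.exists_mem_support (θ, S, 1, 0)
    obtain ⟨ω₂, hω₂, h₂, h₂'⟩ := exists_mem_support_of_mutualInfo_eq_zero s.privacy hω₁ hω₀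
    simp only [Prod.mk.injEq] at h₁ h₂ h₂'
    refine ⟨s.Λ ω₂, fun w => ?_⟩
    obtain ⟨ω₃, hω₃, h₃⟩ := s.uniform.exists_mem_support (θ, S, 1, w)
    obtain ⟨ω, hω, h, h'⟩ := exists_mem_support_of_mutualInfo_eq_zero s.query_indep hω₃ hω₂
    simp only [Prod.mk.injEq] at h₃
    refine ⟨ω, hω, h.trans h₃.2.2.2, h'.trans ?_⟩
    rw [h₂'.1, h₂.1, h₂.2, h₁.1, h₁.2.1]
  refine PCSI.card_mul_le_sum_length (f (s.Q ω₀)) ?_ _ ?_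
  · intro w w' h
    obtain ⟨Λ, hΛ⟩ := hex (s.θ ω₀) (s.S ω₀)
    obtain ⟨ω, hω, rfl, e⟩ := hΛ w
    obtain ⟨ω', hω', rfl, e'⟩ := hΛ w'
    simp only [Prod.mk.injEq] at e e'
    have hd := hf ω hω
    have hd' := hf ω' hω'
    rw [e.1] at hd
    rw [e'.1] at hd'
    rw [← hd, ← hd'] at h ⊢
    exact s.answer_prefix ω hω ω' hω' (e.1.trans e'.1.symm) h
  · refine card_fibre_mul_le hM hMK (f (s.Q ω₀)) fun θ S => ?_
    obtain ⟨Λ, hΛ⟩ := hex θ S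
    refine ⟨Λ, fun w w' h hY => ?_⟩
    obtain ⟨ω, hω, rfl, e⟩ := hΛ w
    obtain ⟨ω', hω', rfl, e'⟩ := hΛ w'
    simp only [Prod.mk.injEq] at e e'
    have := (condEntropy_eq_zero_iff _ _ _).1 s.correctness ω hω ω' hω' (by
      rw [hf ω hω, hf ω' hω', e.1, e'.1, e.2.1, e'.2.1, e.2.2.1, e'.2.2.1, e.2.2.2, e'.2.2.2,
        h, hY])
    simpa only [e.2.1, e'.2.1] using this

lemma Scheme.le_download [Finite F] (hM : 1 ≤ M) (hMK : M ≤ K) (s : Scheme F K M L) :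
    (((K - max (M - 1) 1) * L : ℕ) : ℝ≥0∞) ≤ s.download := by
  classical
  have := Fintype.ofFinite F
  obtain ⟨f, hf⟩ := s.exists_answer
  have hindep : mutualInfo s.P s.Q s.W = 0 := by
    have h := mutualInfo_comp_eq_zero s.query_indep id Prod.fst
    rw [mutualInfo_eq_zero_iff] at h ⊢
    have h' := congrArg (PMF.map Prod.swap) h
    rw [PMF.map_comp] at h'
    refine h'.trans ?_
    ext ⟨q, w⟩
    rw [prodLaw_apply, PMF.map_apply, tsum_eq_single (w, q)]
    · simp [prodLaw_apply, mul_comm]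
    · rintro ⟨w', q'⟩ hne
      rw [if_neg]
      rintro ⟨⟩
      exact hne rfl
  have hW : IsUniform s.P s.W := by
    obtain ⟨ω, -⟩ := s.P.support_nonempty
    have : Nonempty (Fin K × Support K M × Coeffs F M) := ⟨(s.θ ω, s.S ω, s.Λ ω)⟩
    exact (s.uniform.map_equiv ((Equiv.prodAssoc (Fin K) (Support K M × Coeffs F M)
      (Messages F K L)).trans (Equiv.prodCongr (Equiv.refl _) (Equiv.prodAssoc _ _ _))).symm).snd
  set d := (K - max (M - 1) 1) * L
  -- Independence of query and messages splits the average, so the bound for each single query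
  -- applies.
  have hD : s.download = ∑' q, s.P.map s.Q q * ∑ w, s.P.map s.W w * ((f q w).length : ℝ≥0∞) := by
    calc s.download = ∑' ω, s.P ω * ((f (s.Q ω) (s.W ω)).length : ℝ≥0∞) := by
          refine tsum_congr fun ω => ?_
          by_cases hω : s.P ω = 0
          · simp [hω]
          · rw [hf ω hω]
      _ = ∑' z : s.Query × Messages F K L, s.P.map (fun ω => (s.Q ω, s.W ω)) z *
            ((f z.1 z.2).length : ℝ≥0∞) :=
          (tsum_map_mul s.P (fun ω => (s.Q ω, s.W ω)) fun z => ((f z.1 z.2).length : ℝ≥0∞)).symm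
      _ = ∑' q, ∑' w, s.P.map s.Q q * s.P.map s.W w * ((f q w).length : ℝ≥0∞) := by
          rw [← ENNReal.tsum_prod (f := fun q w =>
            s.P.map s.Q q * s.P.map s.W w * ((f q w).length : ℝ≥0∞))]
          exact tsum_congr fun ⟨q, w⟩ => by rw [map_pair_apply_of_mutualInfo_eq_zero hindep]
      _ = _ := by simp only [tsum_fintype, mul_assoc, Finset.mul_sum]
  rw [hD]
  calc (d : ℝ≥0∞) = ∑' q, s.P.map s.Q q * d := by
        rw [ENNReal.tsum_mul_right, PMF.tsum_coe, one_mul]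
    _ ≤ _ := by
        refine ENNReal.tsum_le_tsum fun q => ?_
        by_cases hq : s.P.map s.Q q = 0
        · simp [hq]
        obtain ⟨ω₀, hω₀, rfl⟩ := (PMF.mem_support_map_iff ..).1 ((PMF.mem_support_iff _ _).2 hq)
        gcongr
        have h := s.card_mul_le_sum_length hM hMK hf hω₀
        have hc : (Fintype.card (Messages F K L) : ℝ≥0∞) ≠ 0 := by simp
        simp_rw [hW _]
        rw [← Finset.mul_sum, Nat.card_eq_fintype_card, mul_comm _ (Finset.sum ..),
          ← div_eq_mul_inv, ENNReal.le_div_iff_mul_le (Or.inl hc) (Or.inl (by simp)), mul_comm]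
        exact_mod_cast h

end Converse


/-! ### Schemes with randomly scaled messages -/

section Achievability

variable {F : Type} [Field F] {K M : ℕ}

/-- Enumeration of the messages that lists those in the support `S` first. -/
def supportEquiv (S : Support K M) : Fin M ⊕ Fin (K - M) ≃ Fin K :=
  finSumEquivOfFinset S.2 (by rw [Finset.card_compl, S.2, Fintype.card_fin])

lemma supportEquiv_inl (S : Support K M) (m : Fin M) :
    supportEquiv S (Sum.inl m) = S.1.orderEmbOfFin S.2 m := rfl

/-- The data `(θ, S, Λ, W)` of the problem for `L = 1`, together with `K - M` private nonzero
scalars of the user. -/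
abbrev Sample (F : Type) [Field F] (K M : ℕ) : Type :=
  (Fin K × Support K M × Coeffs F M × Messages F K 1) × (Fin (K - M) → Fˣ)

/-- The coefficients `Λ` on the support and private random scalars off it, multiplied by a factor
`t` depending on `θ` and `S`. -/
def scaling (t : Fin K → Support K M → Fin K → Fˣ) (ω : Sample F K M) (i : Fin K) : Fˣ :=
  Sum.elim ω.1.2.2.1 ω.2 ((supportEquiv ω.1.2.1).symm i) * t ω.1.1 ω.1.2.1 i

/-- Given `θ` and `S`, the scaling is a bijective function of the coefficients and the private
scalars. -/
def scalingEquiv (t : Fin K → Support K M → Fin K → Fˣ) :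
    Sample F K M ≃ (Fin K × Support K M) × ((Fin K → Fˣ) × Messages F K 1) where
  toFun ω := ((ω.1.1, ω.1.2.1), (scaling t ω, ω.1.2.2.2))
  invFun z :=
    ((z.1.1, z.1.2, fun m => z.2.1 (supportEquiv z.1.2 (Sum.inl m)) /
      t z.1.1 z.1.2 (supportEquiv z.1.2 (Sum.inl m)), z.2.2),
      fun j => z.2.1 (supportEquiv z.1.2 (Sum.inr j)) /
        t z.1.1 z.1.2 (supportEquiv z.1.2 (Sum.inr j)))
  left_inv := by
    rintro ⟨⟨θ, S, Λ, W⟩, r⟩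
    simp [scaling]
  right_inv := by
    rintro ⟨⟨θ, S⟩, s, W⟩
    simp only [Prod.mk.injEq, and_true, true_and]
    funext i
    obtain ⟨x, rfl⟩ := (supportEquiv S).surjective i
    rcases x with m | j <;> simp [scaling]

/-- Separation of the messages from all other variables. -/
def messagesEquiv : Sample F K M ≃
    Messages F K 1 × (Fin K × Support K M × Coeffs F M × (Fin (K - M) → Fˣ)) where
  toFun ω := (ω.1.2.2.2, ω.1.1, ω.1.2.1, ω.1.2.2.1, ω.2)
  invFun z := ((z.2.1, z.2.2.1, z.2.2.2.1, z.1), z.2.2.2.2)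
  left_inv _ := rfl
  right_inv _ := rfl

/-- The scheme whose query is a scaling, answered by `n` symbols given by `A`. -/
def scalingScheme [Fintype F] [DecidableEq F] [Nonempty (Fin K)] [Nonempty (Support K M)]
    (t : Fin K → Support K M → Fin K → Fˣ) {n : ℕ}
    (A : (Fin K → Fˣ) → Messages F K 1 → Fin n → F)
    (hA : ∀ (θ : Fin K) (S : Support K M) (Λ : Coeffs F M) (s : Fin K → Fˣ),
      (∀ m, s (S.1.orderEmbOfFin S.2 m) = Λ m * t θ S (S.1.orderEmbOfFin S.2 m)) →
      ∀ W W' : Messages F K 1, A s W = A s W' → sideInfo S Λ W = sideInfo S Λ W' →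
        W θ = W' θ) :
    Scheme F K M 1 where
  Ω := Sample F K M
  P := PMF.uniformOfFintype _
  θ ω := ω.1.1
  S ω := ω.1.2.1
  Λ ω := ω.1.2.2.1
  W ω := ω.1.2.2.2
  Query := Fin K → Fˣ
  Q := scaling t
  Δ ω := List.ofFn (A (scaling t ω) ω.1.2.2.2)
  uniform := isUniform_fst
  query_indep := mutualInfo_comp_eq_zero (mutualInfo_uniformOfFintype_eq_zero messagesEquiv) id
    fun y => (scaling t ((y.1, y.2.1, y.2.2.1, 0), y.2.2.2), y.1, y.2.1, y.2.2.1)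
  privacy := mutualInfo_uniformOfFintype_eq_zero (scalingEquiv t)
  answer_determined := by
    rw [condEntropy_eq_zero_iff]
    rintro ω - ω' - h
    obtain ⟨h₁, h₂⟩ := Prod.mk.inj h
    rw [h₁, h₂]
  answer_prefix ω _ ω' _ _ h := h.eq_of_length (by simp)
  correctness := by
    rw [condEntropy_eq_zero_iff]
    rintro ⟨⟨θ, S, Λ, W⟩, r⟩ - ⟨⟨θ', S', Λ', W'⟩, r'⟩ - h
    simp only [Prod.mk.injEq] at h
    obtain ⟨hΔ, hQ, hY, rfl, rfl, rfl⟩ := h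
    rw [hQ] at hΔ
    refine hA θ S Λ _ (fun m => ?_) W W' (List.ofFn_injective hΔ) hY
    rw [← supportEquiv_inl]
    simp [scaling]

lemma Scheme.rate_eq_of_length_eq {L n : ℕ} (s : Scheme F K M L)
    (h : ∀ ω, (s.Δ ω).length = n) : s.rate = L / n := by
  simp only [Scheme.rate, Scheme.download, h]
  rw [ENNReal.tsum_mul_right, PMF.tsum_coe, one_mul]

lemma rate_scalingScheme [Fintype F] [DecidableEq F] [Nonempty (Fin K)] [Nonempty (Support K M)]
    (t : Fin K → Support K M → Fin K → Fˣ) {n : ℕ}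
    (A : (Fin K → Fˣ) → Messages F K 1 → Fin n → F) (hA) :
    (scalingScheme t A hA).rate = 1 / n := by
  rw [Scheme.rate_eq_of_length_eq (n := n) _ fun ω => by simp [scalingScheme], Nat.cast_one]

lemma Scheme.rate_le_supCapacity [Finite F] {L : ℕ} (hL : 1 ≤ L) (s : Scheme F K M L) :
    s.rate ≤ supCapacity K M :=
  le_iSup_of_le F <| le_iSup_of_le ‹_› <| le_iSup_of_le ‹_› <| le_iSup_of_le L <|
    le_iSup_of_le hL <| le_iSup_of_le s le_rfl

lemma nonempty_support (hMK : M ≤ K) : Nonempty (Support K M) := by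
  obtain ⟨S, -, hS⟩ := Finset.exists_subset_card_eq (s := (Finset.univ : Finset (Fin K)))
    (n := M) (by simpa using hMK)
  exact ⟨S, hS⟩

/-- Downloading all differences with one fixed message works for uncoded side information. -/
lemma one_div_le_supCapacity_one (hK : 1 ≤ K) : 1 / ((K - 1 : ℕ) : ℝ≥0∞) ≤ supCapacity K 1 := by
  obtain ⟨k, rfl⟩ := Nat.exists_eq_add_of_le' hK
  have := nonempty_support hK
  refine le_trans (le_of_eq ?_) (Scheme.rate_le_supCapacity le_rfl
    (scalingScheme (F := ZMod 2) (K := k + 1) (M := 1) (n := k) (fun _ _ _ => 1)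
      (fun _ W j => W j.succ 0 - W 0 0) ?_))
  · rw [rate_scalingScheme, Nat.add_sub_cancel]
  · intro θ S Λ s _ W W' hA hY
    -- Equal answers force the two tuples to differ by the same constant in every coordinate; the
    -- uncoded side information makes it zero.
    have hdiff : ∀ i, W i 0 - W' i 0 = W 0 0 - W' 0 0 := by
      refine Fin.cases rfl fun j => ?_
      linear_combination congrFun hA j
    have hY0 := congrFun hY 0
    simp only [sideInfo, Fin.sum_univ_one, Pi.smul_apply, smul_eq_mul] at hY0
    have h0 := mul_left_cancel₀ (Λ 0).ne_zero hY0
    funext l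
    rw [Subsingleton.elim l 0]
    linear_combination hdiff θ - hdiff (S.1.orderEmbOfFin S.2 0) + h0

open Polynomial in
/-- The polynomial vanishing at the evaluation points of all messages other than the desired one
and those in the support of the side information. -/
def locator (x : Fin K → F) (θ : Fin K) (S : Support K M) : F[X] :=
  ∏ j ∈ (insert θ S.1)ᶜ, (X - C (x j))

/-- This bound makes the locator's coefficients a legitimate combination of the `K - M + 1`
downloaded symbols. -/
lemma natDegree_locator_lt (x : Fin K → F) (θ : Fin K) (S : Support K M) :
    (locator x θ S).natDegree < K - M + 1 := by
  rw [locator, Polynomial.natDegree_finsetProd_X_sub_C_eq_card, Finset.card_compl,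
    Fintype.card_fin]
  have := Finset.card_le_card (Finset.subset_insert θ S.1)
  rw [S.2] at this
  omega

lemma eval_locator_ne_zero_iff {x : Fin K → F} (hx : Function.Injective x) (θ : Fin K)
    (S : Support K M) (i : Fin K) :
    (locator x θ S).eval (x i) ≠ 0 ↔ i ∈ insert θ S.1 := by
  simp [locator, Polynomial.eval_prod, Finset.prod_eq_zero_iff, sub_eq_zero, hx.eq_iff,
    or_iff_not_imp_left]

/-- Evaluations of a combination of the messages against the powers `1, x, …, x ^ (K - M)` suffice
to recover the desired message when the scaling is matched to the coefficients of the side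
information everywhere but at the desired message. -/
lemma eq_of_sum_pow_eq {x : Fin K → F} (hx : Function.Injective x) {a : F} (ha : a ≠ 1)
    {θ : Fin K} {S : Support K M} {Λ : Coeffs F M} {s : Fin K → Fˣ}
    (hs : ∀ m, (Λ m : F) * (if S.1.orderEmbOfFin S.2 m = θ then a else 1) =
      s (S.1.orderEmbOfFin S.2 m) * (locator x θ S).eval (x (S.1.orderEmbOfFin S.2 m)))
    {V : Fin K → F} (hA : ∀ j < K - M + 1, ∑ i, (s i : F) * x i ^ j * V i = 0)
    (hY : ∑ m, (Λ m : F) * V (S.1.orderEmbOfFin S.2 m) = 0) : V θ = 0 := by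
  classical
  have hdeg := natDegree_locator_lt x θ S
  have hroot := eval_locator_ne_zero_iff hx θ S
  generalize locator x θ S = p at hs hdeg hroot
  -- Combine the answers with the coefficients of `p`.
  have hp : ∑ i, (s i : F) * p.eval (x i) * V i = 0 := by
    simp_rw [Polynomial.eval_eq_sum_range' hdeg, Finset.mul_sum,
      Finset.sum_mul]
    rw [Finset.sum_comm]
    refine Finset.sum_eq_zero fun j hj => ?_
    have h := hA j (Finset.mem_range.1 hj)
    rw [← mul_zero (p.coeff j), ← h, Finset.mul_sum]
    exact Finset.sum_congr rfl fun i _ => by ring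
  -- `l` is `Λ` extended by zero off the support.
  obtain ⟨l, hl⟩ : ∃ l : Fin K → F, (∀ m, l (S.1.orderEmbOfFin S.2 m) = Λ m) ∧
      ∀ i ∉ S.1, l i = 0 := by
    refine ⟨fun i => Sum.elim (fun m => (Λ m : F)) 0 ((supportEquiv S).symm i), fun m => ?_,
      fun i hi => ?_⟩
    · rw [← supportEquiv_inl]
      simp
    · obtain ⟨z, rfl⟩ := (supportEquiv S).surjective i
      rcases z with m | j
      · exact absurd (S.1.orderEmbOfFin_mem S.2 m) hi
      · simp
  have hY' : ∑ i, l i * V i = 0 := by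
    rw [← (supportEquiv S).sum_comp, Fintype.sum_sum_type, ← hY]
    refine (add_eq_left.2 (Finset.sum_eq_zero fun j _ => ?_)).trans
      (Finset.sum_congr rfl fun m _ => ?_)
    · rw [hl.2, zero_mul]
      have := Finset.orderEmbOfFin_mem (S.1)ᶜ (by rw [Finset.card_compl, S.2, Fintype.card_fin]) j
      exact Finset.mem_compl.1 this
    · rw [supportEquiv_inl, hl.1]
  have hlS : ∀ i ∈ S.1, l i ≠ 0 ∧ l i * (if i = θ then a else 1) = s i * p.eval (x i) := by
    intro i hi
    obtain ⟨m, rfl⟩ : i ∈ Set.range (S.1.orderEmbOfFin S.2) := by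
      rw [Finset.range_orderEmbOfFin]
      exact hi
    rw [hl.1]
    exact ⟨(Λ m).ne_zero, hs m⟩
  have hsub : ∑ i, ((s i : F) * p.eval (x i) - l i) * V i = 0 := by
    simp_rw [sub_mul]
    rw [Finset.sum_sub_distrib, hp, hY', sub_zero]
  -- Only `θ` survives, with coefficient `(a - 1) * l θ` if `θ` lies in `S` and `s θ * p.eval (x θ)`
  -- otherwise; both are nonzero.
  rw [Finset.sum_eq_single θ] at hsub
  · refine (mul_eq_zero.1 hsub).resolve_left ?_
    by_cases hθ : θ ∈ S.1
    · obtain ⟨h1, h2⟩ := hlS θ hθ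
      rw [← h2, if_pos rfl]
      intro h
      exact ha (mul_left_cancel₀ h1 (by linear_combination h))
    · rw [hl.2 θ hθ, sub_zero]
      exact mul_ne_zero (s θ).ne_zero ((hroot θ).2 (by simp))
  · intro i _ hi
    by_cases hiS : i ∈ S.1
    · rw [← (hlS i hiS).2, if_neg hi]
      ring
    · have : p.eval (x i) = 0 := by
        by_contra h
        have := (hroot i).1 h
        simp [hi, hiS] at this
      rw [this, hl.2 i hiS]
      ring
  · simp

/-- A randomly scaled Reed-Solomon code of dimension `K - M + 1` is a query for any side
information. -/
lemma one_div_le_supCapacity (hM : 1 ≤ M) (hMK : M ≤ K) :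
    1 / ((K - M + 1 : ℕ) : ℝ≥0∞) ≤ supCapacity K M := by
  -- The prime must exceed `K - 1` for distinct evaluation points, and exceed `2` so that the
  -- mismatch factor `2` is nonzero.
  obtain ⟨p, hpK, hp⟩ := Nat.exists_infinite_primes (K + 3)
  have : Fact p.Prime := ⟨hp⟩
  have : Nonempty (Fin K) := ⟨⟨0, by omega⟩⟩
  have := nonempty_support hMK
  let x : Fin K → ZMod p := fun i => (i : ℕ)
  have hx : Function.Injective x := by
    intro i j h
    have h' := (ZMod.natCast_eq_natCast_iff' _ _ _).1 h
    rw [Nat.mod_eq_of_lt (by omega), Nat.mod_eq_of_lt (by omega)] at h'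
    exact Fin.ext h'
  have h2 : (2 : ZMod p) ≠ 0 := by
    intro h
    have := (ZMod.natCast_eq_zero_iff 2 p).1 (by exact_mod_cast h)
    have := Nat.le_of_dvd (by norm_num) this
    omega
  have h21 : (2 : ZMod p) ≠ 1 := fun h => one_ne_zero (α := ZMod p) (by linear_combination h)
  -- Dividing by the locator matches the scaling to `Λ` on the support, except for the factor `2` at
  -- `θ`; off the support any unit would do.
  have ht : ∀ (θ : Fin K) (S : Support K M) (i : Fin K), ∃ u : (ZMod p)ˣ,
      i ∈ S.1 → (u : ZMod p) * (locator x θ S).eval (x i) = if i = θ then 2 else 1 := by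
    intro θ S i
    by_cases hi : i ∈ S.1
    · have h := (eval_locator_ne_zero_iff hx θ S i).2 (Finset.mem_insert_of_mem hi)
      refine ⟨Units.mk0 ((if i = θ then 2 else 1) / (locator x θ S).eval (x i))
        (div_ne_zero (by split_ifs <;> simp [h2]) h), fun _ => ?_⟩
      rw [Units.val_mk0, div_mul_cancel₀ _ h]
    · exact ⟨1, fun h => absurd h hi⟩
  choose t ht using ht
  refine le_trans (le_of_eq ?_) (Scheme.rate_le_supCapacity le_rfl
    (scalingScheme t (fun s W (j : Fin (K - M + 1)) =>
      ∑ i, (s i : ZMod p) * x i ^ (j : ℕ) * W i 0) ?_))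
  · rw [rate_scalingScheme]
  · intro θ S Λ s hs W W' hA hY
    have hV : W θ 0 - W' θ 0 = 0 := by
      refine eq_of_sum_pow_eq (V := fun i => W i 0 - W' i 0) hx h21 (θ := θ) (S := S) (Λ := Λ)
        (s := s) (fun m => ?_) (fun j hj => ?_) ?_
      · rw [hs, Units.val_mul, mul_assoc, ht θ S _ (S.1.orderEmbOfFin_mem S.2 m)]
      · have := congrFun hA ⟨j, hj⟩
        simp only [mul_sub, Finset.sum_sub_distrib]
        exact sub_eq_zero.2 this
      · have := congrFun hY 0
        simp only [sideInfo, Finset.sum_apply, Pi.smul_apply, smul_eq_mul] at this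
        simp only [mul_sub, Finset.sum_sub_distrib]
        exact sub_eq_zero.2 this
    funext l
    rw [Subsingleton.elim l 0]
    exact sub_eq_zero.1 hV

end Achievability

lemma supCapacity_le {K M : ℕ} (hM : 1 ≤ M) (hMK : M ≤ K) :
    supCapacity K M ≤ 1 / ((K - max (M - 1) 1 : ℕ) : ℝ≥0∞) := by
  refine iSup_le fun F => iSup_le fun _ => iSup_le fun _ => iSup_le fun L => iSup_le fun hL =>
    iSup_le fun s => ?_
  have h := s.le_download hM hMK
  have hL0 : (L : ℝ≥0∞) ≠ 0 := by
    rw [Nat.cast_ne_zero]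
    omega
  calc s.rate ≤ (L : ℝ≥0∞) / (((K - max (M - 1) 1) * L : ℕ) : ℝ≥0∞) := by
        unfold Scheme.rate
        gcongr
    _ = 1 / ((K - max (M - 1) 1 : ℕ) : ℝ≥0∞) := by
        rw [Nat.cast_mul]
        conv_lhs => enter [1]; rw [← one_mul (L : ℝ≥0∞)]
        exact ENNReal.mul_div_mul_right _ _ hL0 (by simp)

lemma supCapacity_one {K : ℕ} (hK : 1 ≤ K) : supCapacity K 1 = 1 / ((K : ℝ≥0∞) - 1) := by
  have hc : (K : ℝ≥0∞) - 1 = ((K - 1 : ℕ) : ℝ≥0∞) := by push_cast; rfl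
  rw [hc]
  exact le_antisymm (supCapacity_le le_rfl hK) (one_div_le_supCapacity_one hK)

lemma supCapacity_of_two_le {K M : ℕ} (hM : 2 ≤ M) (hMK : M ≤ K) :
    supCapacity K M = 1 / ((K : ℝ≥0∞) - M + 1) := by
  have hc : (K : ℝ≥0∞) - M + 1 = ((K - M + 1 : ℕ) : ℝ≥0∞) := by push_cast; rfl
  rw [hc]
  refine le_antisymm ?_ (one_div_le_supCapacity (by omega) hMK)
  have := supCapacity_le (by omega : 1 ≤ M) hMK
  rwa [show K - max (M - 1) 1 = K - M + 1 by omega] at this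

end PCSI

end

theorem theorem10 (K M : ℕ) (hM : 1 ≤ M) (hMK : M ≤ K) :
    PCSI.supCapacity K M
        = max (1 / ((K : ENNReal) - 1)) (1 / ((K : ENNReal) - (M : ENNReal) + 1)) ∧
      (M = 1 → PCSI.supCapacity K M = 1 / ((K : ENNReal) - 1)) ∧
      (2 ≤ M → PCSI.supCapacity K M = 1 / ((K : ENNReal) - (M : ENNReal) + 1)) := by
  refine ⟨?_, fun h => h ▸ PCSI.supCapacity_one (hM.trans hMK),
    fun h => PCSI.supCapacity_of_two_le h hMK⟩
  rcases hM.eq_or_lt with rfl | h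
  · rw [PCSI.supCapacity_one hMK, max_eq_left]
    gcongr
    rw [Nat.cast_one]
    exact le_self_add
  · rw [PCSI.supCapacity_of_two_le h hMK, max_eq_right]
    gcongr
    -- The comparison is made in `ℕ`, where `2 ≤ M ≤ K` settles it; casts commute with truncated
    -- subtraction.
    have h1 : ((K - M + 1 : ℕ) : ENNReal) ≤ ((K - 1 : ℕ) : ENNReal) := by
      rw [Nat.cast_le]
      omega
    push_cast at h1
    exact h1
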